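/- Let $\mathcal L=(\mathcal L_1,\dots,\mathcal L_6):\mathbb C^8\to\mathbb R^6$ be the momentum map $$\mathcal L(z)=-\tfrac12\begin{pmatrix}|z_1|^2+|z_5|^2-6\\ |z_2|^2+|z_5|^2+|z_7|^2-10\\ |z_3|^2+|z_7|^2-6\\ |z_4|^2-|z_5|^2+|z_7|^2-4\\ |z_5|^2-|z_6|^2+|z_7|^2-2\\ |z_5|^2-|z_7|^2+|z_8|^2-4\end{pmatrix},$$ which generates a $\mathbb T^6$-action on $\mathbb C^8$: the $j$-th circle factor $e^{i\theta}$ multiplies $z_k$ by $e^{i\theta w_{jk}}$, where $w_{jk}$ is the coefficient of $|z_k|^2$ in the $j$-th row. Let $M=\mathcal L^{-1}(0)/\mathbb T^6$ be the symplectic quotient, a smooth manifold of dimension $4$, and write $[z]=[z_1,\dots,z_8]\in M$ for the class of $z\in\mathcal L^{-1}(0)$. For $t=(t_1,t_2,t_3,t_4)\in\mathbb R^4$ let $F_t=(J,H_t):M\to\mathbb R^2$ be given by $$J([z])=\tfrac12|z_1|^2,\qquad H([z])=\tfrac12|z_3|^2,\qquad H_t=(1-2t_1)H+\sum_{j=1}^4t_j\gamma_j,$$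 $$\gamma_1([z])=\tfrac1{50}\,\Re(\overline{z_2z_3z_4}\,z_6z_7z_8),\quad \gamma_2([z])=\tfrac1{50}|z_5|^4|z_4|^4,\quad \gamma_3([z])=\tfrac1{50}|z_4|^4|z_7|^4,\quad \gamma_4([z])=\tfrac1{100}|z_5|^4|z_7|^4 .$$ A point $p\in M$ is a singular point of $(J,H_t)$ of rank $r$ if $r=\operatorname{rank} dF_t(p)<2$. The four points $$[\sqrt2,0,0,\sqrt2,2,2\sqrt2,\sqrt6,\sqrt6],\quad [2,\sqrt2,0,0,\sqrt2,\sqrt6,\sqrt6,2\sqrt2],\quad [2,2\sqrt2,\sqrt6,\sqrt6,\sqrt2,0,0,\sqrt2],\quad [\sqrt2,\sqrt6,\sqrt6,2\sqrt2,2,\sqrt2,0,0]$$ of $M$ are called the invariant singular points. **Theorem.** Let $t\in\mathbb R^4$ and let $[z_1,\dots,z_8]\in M$ be a singular point of rank zero of $(J,H_t)$ that is not one of the four invariant singular points. Then $z_1=0$ or $z_5=0$. If $z_1=0$, then $J([z_1,\dots,z_8])=0$; if $z_5=0$, then $J([z_1,\dots,z_8])=3$. -/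

import Mathlib

open scoped Manifold ContDiff

noncomputable section

namespace Octagon

/-! ### The symplectic quotient of the level set by the torus -/

/-- The integer weights of the `𝕋⁶`-action on `ℂ⁸`; the row `j` lists the coefficients of
`|z_1|², …, |z_8|²` in the `j`-th manifold equation. -/
def weight : Fin 6 → Fin 8 → ℤ :=
  ![![1, 0, 0, 0, 1, 0, 0, 0],
    ![0, 1, 0, 0, 1, 0, 1, 0],
    ![0, 0, 1, 0, 0, 0, 1, 0],
    ![0, 0, 0, 1, -1, 0, 1, 0],
    ![0, 0, 0, 0, 1, -1, 1, 0],
    ![0, 0, 0, 0, 1, 0, -1, 1]]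

/-- The constants of the six manifold equations. -/
def offset : Fin 6 → ℤ := ![6, 10, 6, 4, 2, 4]

/-- The momentum map `𝓛 : ℂ⁸ → ℝ⁶`. -/
def momentL (z : Fin 8 → ℂ) (j : Fin 6) : ℝ :=
  -1 / 2 * (∑ k, (weight j k : ℝ) * ‖z k‖ ^ 2 - offset j)

/-- The level set `𝓛⁻¹(0) ⊆ ℂ⁸`. -/
def levelSet : Set (Fin 8 → ℂ) := {z | momentL z = 0}

/-- The torus `𝕋⁶`. -/
abbrev Torus : Type := Fin 6 → Circle

/-- The character by which `s ∈ 𝕋⁶` multiplies the coordinate `z_k`. The Hamiltonian flow of the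
`j`-th component of `𝓛` at time `θ` multiplies `z_k` by `exp (i θ * weight j k)`. -/
def torusChar (s : Torus) (k : Fin 8) : Circle := ∏ j, s j ^ weight j k

theorem torusChar_one (k : Fin 8) : torusChar 1 k = 1 := by simp [torusChar]

theorem torusChar_mul (s t : Torus) (k : Fin 8) :
    torusChar (s * t) k = torusChar s k * torusChar t k := by
  simp [torusChar, mul_zpow, Finset.prod_mul_distrib]

theorem momentL_char (s : Torus) (z : Fin 8 → ℂ) :
    momentL (fun k => (torusChar s k : ℂ) * z k) = momentL z := by
  funext j
  simp only [momentL, norm_mul, Circle.norm_coe, one_mul]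

/-- The action of `𝕋⁶` on `𝓛⁻¹(0)` generated by `𝓛`. -/
instance : MulAction Torus levelSet where
  smul s z := ⟨fun k => (torusChar s k : ℂ) * z.1 k, by
    show momentL _ = 0
    rw [momentL_char]; exact z.2⟩
  one_smul z := Subtype.ext <| funext fun k => by
    show (torusChar 1 k : ℂ) * z.1 k = z.1 k
    simp [torusChar_one]
  mul_smul s t z := Subtype.ext <| funext fun k => by
    show (torusChar (s * t) k : ℂ) * z.1 k = (torusChar s k : ℂ) * ((torusChar t k : ℂ) * z.1 k)
    simp [torusChar_mul, mul_assoc]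

theorem smul_apply (s : Torus) (z : levelSet) (k : Fin 8) :
    (s • z).1 k = (torusChar s k : ℂ) * z.1 k := rfl

instance : ContinuousConstSMul Torus levelSet where
  continuous_const_smul s := by
    refine Continuous.subtype_mk (continuous_pi fun k => ?_) _
    exact continuous_const.mul ((continuous_apply k).comp continuous_subtype_val)

/-- The manifold `M = 𝓛⁻¹(0) / 𝕋⁶`. -/
def M : Type := MulAction.orbitRel.Quotient Torus levelSet

/-- `M` carries the quotient topology. -/
instance : TopologicalSpace M :=
  inferInstanceAs (TopologicalSpace (Quotient (MulAction.orbitRel Torus levelSet)))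

/-- The class `[z] = [z_1, …, z_8] ∈ M` of `z ∈ 𝓛⁻¹(0)`. -/
def mk (z : levelSet) : M := Quotient.mk (MulAction.orbitRel Torus levelSet) z

/-- A function on `𝓛⁻¹(0)` that is invariant under the torus descends to `M`. -/
def descend {α : Type*} (f : (Fin 8 → ℂ) → α)
    (hf : ∀ (s : Torus) (z : Fin 8 → ℂ), f (fun k => (torusChar s k : ℂ) * z k) = f z) : M → α :=
  Quotient.lift (fun z : levelSet => f z.1) (by
    rintro a b ⟨s, rfl⟩
    exact hf s b.1)

theorem descend_mk {α : Type*} (f : (Fin 8 → ℂ) → α)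
    (hf : ∀ (s : Torus) (z : Fin 8 → ℂ), f (fun k => (torusChar s k : ℂ) * z k) = f z)
    (z : levelSet) : descend f hf (mk z) = f z.1 := rfl

theorem isOpenMap_mk : IsOpenMap mk := isOpenMap_quotient_mk'_mul (Γ := Torus) (T := levelSet)

theorem continuous_mk : Continuous mk := continuous_quotient_mk'

theorem mk_surjective : Function.Surjective mk := Quotient.mk_surjective

theorem mk_eq_of_char (s : Torus) (y z : levelSet)
    (h : ∀ k, y.1 k = (torusChar s k : ℂ) * z.1 k) : mk y = mk z :=
  Quotient.sound (s := MulAction.orbitRel Torus levelSet)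
    ⟨s, (Subtype.ext (funext fun k => (h k).symm) : s • z = y)⟩

/-! ### The coordinate charts -/

/-- The inward normal vectors of the octagon. -/
def normal : Fin 8 → ℤ × ℤ :=
  ![(1, 0), (1, 1), (0, 1), (-1, 1), (-1, 0), (-1, -1), (0, -1), (1, -1)]

/-- The octagon consists of the `x ∈ ℝ²` with `⟨x, normal k⟩ + support k ≥ 0` for all `k`. -/
def support : Fin 8 → ℤ := ![0, -1, 0, 2, 3, 5, 3, 2]

/-- `normal k = expA ν k • normal ν + expB ν k • normal (ν + 1)`, see `normal_eq`. -/
def expA (ν k : Fin 8) : ℤ :=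
  (normal k).1 * (normal (ν + 1)).2 - (normal k).2 * (normal (ν + 1)).1

/-- See `expA`. -/
def expB (ν k : Fin 8) : ℤ :=
  (normal ν).1 * (normal k).2 - (normal ν).2 * (normal k).1

/-- The value of `|z_k|²` at the point of `M` with `z_ν = z_{ν + 1} = 0`. -/
def expC (ν k : Fin 8) : ℤ :=
  2 * (support k - expA ν k * support ν - expB ν k * support (ν + 1))

theorem normal_eq : ∀ ν k, normal k = expA ν k • normal ν + expB ν k • normal (ν + 1) := by
  decide

/-- `|z_k|²` as a function of the chart coordinates `w = (z_ν, z_{ν + 1})`. -/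
def radicand (ν : Fin 8) (w : ℂ × ℂ) (k : Fin 8) : ℝ :=
  expA ν k * ‖w.1‖ ^ 2 + expB ν k * ‖w.2‖ ^ 2 + expC ν k

/-- The parametrisation `φ_ν` as a map to `ℂ⁸`: the coordinates `z_ν` and `z_{ν + 1}` are free and
the other six are the positive square roots prescribed by the manifold equations. -/
def param (ν : Fin 8) (w : ℂ × ℂ) (k : Fin 8) : ℂ :=
  if k = ν then w.1 else if k = ν + 1 then w.2 else ((√(radicand ν w k) : ℝ) : ℂ)

/-- The domain of `φ_ν`: all expressions under the square roots are positive. -/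
def chartDomain (ν : Fin 8) : Set (ℂ × ℂ) :=
  {w | ∀ k, k ≠ ν → k ≠ ν + 1 → 0 < radicand ν w k}

theorem normSq_param {ν : Fin 8} {w : ℂ × ℂ} (hw : w ∈ chartDomain ν) (k : Fin 8) :
    ‖param ν w k‖ ^ 2 = radicand ν w k := by
  by_cases h1 : k = ν
  · subst h1
    have h : expA k k = 1 ∧ expB k k = 0 ∧ expC k k = 0 := by clear hw; revert k; decide
    simp [param, radicand, h]
  by_cases h2 : k = ν + 1
  · subst h2
    have h : expA ν (ν + 1) = 0 ∧ expB ν (ν + 1) = 1 ∧ expC ν (ν + 1) = 0 := by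
      clear h1 hw; revert ν; decide
    simp [param, radicand, h]
  · have h := hw k h1 h2
    simp [param, h1, h2, Complex.norm_real, Real.sq_sqrt h.le]

theorem weight_exp (ν : Fin 8) (j : Fin 6) :
    ∑ k, weight j k * expA ν k = 0 ∧ ∑ k, weight j k * expB ν k = 0 ∧
      ∑ k, weight j k * expC ν k = offset j := by
  revert ν j; decide

theorem param_mem {ν : Fin 8} {w : ℂ × ℂ} (hw : w ∈ chartDomain ν) : param ν w ∈ levelSet := by
  show momentL _ = 0
  funext j
  obtain ⟨h1, h2, h3⟩ := weight_exp ν j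
  replace h1 : ∑ k, (weight j k : ℝ) * expA ν k = 0 := by exact_mod_cast h1
  replace h2 : ∑ k, (weight j k : ℝ) * expB ν k = 0 := by exact_mod_cast h2
  replace h3 : ∑ k, (weight j k : ℝ) * expC ν k = offset j := by exact_mod_cast h3
  have : ∑ k, (weight j k : ℝ) * ‖param ν w k‖ ^ 2 =
      (∑ k, (weight j k : ℝ) * expA ν k) * ‖w.1‖ ^ 2 +
      (∑ k, (weight j k : ℝ) * expB ν k) * ‖w.2‖ ^ 2 + ∑ k, (weight j k : ℝ) * expC ν k := by
    simp only [Finset.sum_mul, ← Finset.sum_add_distrib]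
    refine Finset.sum_congr rfl fun k _ => ?_
    rw [normSq_param hw, radicand]; ring
  simp [momentL, this, h1, h2, h3]

/-- The values of `|z_k|²` on the level set in terms of `|z_1|²` and `|z_3|²`. -/
theorem normSq_levelSet {z : Fin 8 → ℂ} (hz : z ∈ levelSet) (k : Fin 8) :
    ‖z k‖ ^ 2 = (normal k).1 * ‖z 0‖ ^ 2 + (normal k).2 * ‖z 2‖ ^ 2 + 2 * support k := by
  have h : ∀ j, momentL z j = 0 := fun j => congrFun hz j
  have h0 := h 0
  have h1 := h 1
  have h2 := h 2
  have h3 := h 3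
  have h4 := h 4
  have h5 := h 5
  simp [momentL, weight, offset, Fin.sum_univ_succ] at h0 h1 h2 h3 h4 h5
  fin_cases k <;> simp [normal, support] <;> linarith

theorem normSq_eq_radicand {z : Fin 8 → ℂ} (hz : z ∈ levelSet) (ν k : Fin 8) {w : ℂ × ℂ}
    (h1 : ‖w.1‖ = ‖z ν‖) (h2 : ‖w.2‖ = ‖z (ν + 1)‖) : ‖z k‖ ^ 2 = radicand ν w k := by
  have h := normal_eq ν k
  have ha : ((normal k).1 : ℝ) = expA ν k * (normal ν).1 + expB ν k * (normal (ν + 1)).1 := by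
    exact_mod_cast congrArg Prod.fst h
  have hb : ((normal k).2 : ℝ) = expA ν k * (normal ν).2 + expB ν k * (normal (ν + 1)).2 := by
    exact_mod_cast congrArg Prod.snd h
  rw [radicand, h1, h2, normSq_levelSet hz k, normSq_levelSet hz ν, normSq_levelSet hz (ν + 1),
    ha, hb, expC]
  push_cast
  ring

/-- The six indices different from `ν` and `ν + 1`. -/
def others (ν : Fin 8) : Finset (Fin 8) := Finset.univ.filter fun k => k ≠ ν ∧ k ≠ ν + 1

theorem mem_others {ν k : Fin 8} : k ∈ others ν ↔ k ≠ ν ∧ k ≠ ν + 1 := by simp [others]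

theorem prod_split {G : Type*} [CommMonoid G] (ν : Fin 8) (f : Fin 8 → G) :
    ∏ k, f k = f ν * f (ν + 1) * ∏ k ∈ others ν, f k := by
  have h : (Finset.univ : Finset (Fin 8)) = insert ν (insert (ν + 1) (others ν)) := by
    revert ν; decide
  have h1 : ν ∉ insert (ν + 1) (others ν) := by revert ν; decide
  have h2 : ν + 1 ∉ others ν := by revert ν; decide
  rw [h, Finset.prod_insert h1, Finset.prod_insert h2, mul_assoc]

theorem exp_diag (ν : Fin 8) : expA ν ν = 1 ∧ expA ν (ν + 1) = 0 ∧ expB ν ν = 0 ∧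
    expB ν (ν + 1) = 1 := by
  revert ν; decide

theorem prod_char (s : Torus) (e : Fin 8 → ℤ) (he : ∀ j, ∑ k, weight j k * e k = 0) :
    ∏ k, torusChar s k ^ e k = 1 := by
  simp only [torusChar, ← Finset.prod_zpow, ← zpow_mul]
  rw [Finset.prod_comm]
  refine Finset.prod_eq_one fun j _ => ?_
  have : ∀ (a : Circle) (f : Fin 8 → ℤ), ∏ k, a ^ f k = a ^ ∑ k, f k := fun a f => by
    simp [Fin.prod_univ_succ, Fin.sum_univ_succ, zpow_add]
  rw [this, he, zpow_zero]

theorem char_A (s : Torus) (ν : Fin 8) :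
    torusChar s ν * ∏ k ∈ others ν, torusChar s k ^ expA ν k = 1 := by
  have h := prod_char s (expA ν) fun j => (weight_exp ν j).1
  rw [prod_split ν] at h
  simpa [exp_diag ν] using h

theorem char_B (s : Torus) (ν : Fin 8) :
    torusChar s (ν + 1) * ∏ k ∈ others ν, torusChar s k ^ expB ν k = 1 := by
  have h := prod_char s (expB ν) fun j => (weight_exp ν j).2.1
  rw [prod_split ν] at h
  simpa [exp_diag ν] using h

/-- The chart coordinates: `z_ν` and `z_{ν + 1}` after the torus has been used to make the other six
coordinates positive. -/
def coord (ν : Fin 8) (z : Fin 8 → ℂ) : ℂ × ℂ :=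
  (z ν * ∏ k ∈ others ν, (z k / ‖z k‖) ^ expA ν k,
    z (ν + 1) * ∏ k ∈ others ν, (z k / ‖z k‖) ^ expB ν k)

theorem coe_prod (S : Finset (Fin 8)) (f : Fin 8 → Circle) :
    ((∏ k ∈ S, f k : Circle) : ℂ) = ∏ k ∈ S, (f k : ℂ) := map_prod Circle.coeHom f S

theorem coord_char (ν : Fin 8) (s : Torus) (z : Fin 8 → ℂ) :
    coord ν (fun k => (torusChar s k : ℂ) * z k) = coord ν z := by
  have hA : (torusChar s ν : ℂ) * ∏ k ∈ others ν, (torusChar s k : ℂ) ^ expA ν k = 1 := by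
    have := congrArg (fun c : Circle => (c : ℂ)) (char_A s ν)
    simpa [coe_prod] using this
  have hB : (torusChar s (ν + 1) : ℂ) * ∏ k ∈ others ν, (torusChar s k : ℂ) ^ expB ν k = 1 := by
    have := congrArg (fun c : Circle => (c : ℂ)) (char_B s ν)
    simpa [coe_prod] using this
  simp only [coord, norm_mul, Circle.norm_coe, one_mul, mul_div_assoc, mul_zpow,
    Finset.prod_mul_distrib]
  refine Prod.ext ?_ ?_
  · linear_combination (z ν * ∏ k ∈ others ν, (z k / ‖z k‖) ^ expA ν k) * hA
  · linear_combination (z (ν + 1) * ∏ k ∈ others ν, (z k / ‖z k‖) ^ expB ν k) * hB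

/-- The domain in `ℂ⁸` on which `coord ν` is smooth. -/
def nonvanishing (ν : Fin 8) : Set (Fin 8 → ℂ) := {z | ∀ k, k ≠ ν → k ≠ ν + 1 → z k ≠ 0}

theorem isOpen_nonvanishing (ν : Fin 8) : IsOpen (nonvanishing ν) := by
  simp only [nonvanishing, Set.ofPred_forall]
  refine isOpen_iInter_of_finite fun k => isOpen_iInter_of_finite fun _ =>
    isOpen_iInter_of_finite fun _ => ?_
  exact isOpen_ne_fun (continuous_apply k) continuous_const

/-- The set `U_ν ⊆ M` where at most `z_ν` and `z_{ν + 1}` vanish. -/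
def U (ν : Fin 8) : Set M := {p | ∃ z : levelSet, mk z = p ∧ z.1 ∈ nonvanishing ν}

theorem mk_mem_U {ν : Fin 8} {z : levelSet} : mk z ∈ U ν ↔ z.1 ∈ nonvanishing ν := by
  constructor
  · rintro ⟨y, hy, h⟩
    obtain ⟨s, hs⟩ := Quotient.exact (s := MulAction.orbitRel Torus levelSet) hy
    intro k h1 h2 h0
    apply h k h1 h2
    rw [← hs]
    show (torusChar s k : ℂ) * z.1 k = 0
    rw [h0, mul_zero]
  · exact fun h => ⟨z, rfl, h⟩

theorem isOpen_U (ν : Fin 8) : IsOpen (U ν) := by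
  have : U ν = mk '' (Subtype.val ⁻¹' nonvanishing ν) := by
    ext p
    simp only [U, Set.mem_ofPred_eq, Set.mem_image, Set.mem_preimage]
    exact exists_congr fun z => and_comm
  rw [this]
  exact isOpenMap_mk _ ((isOpen_nonvanishing ν).preimage continuous_subtype_val)

theorem isOpen_chartDomain (ν : Fin 8) : IsOpen (chartDomain ν) := by
  simp only [chartDomain, Set.ofPred_forall]
  refine isOpen_iInter_of_finite fun k => isOpen_iInter_of_finite fun _ =>
    isOpen_iInter_of_finite fun _ => ?_
  refine isOpen_lt continuous_const ?_
  unfold radicand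
  fun_prop

theorem zero_mem_chartDomain (ν : Fin 8) : (0 : ℂ × ℂ) ∈ chartDomain ν := by
  intro k h1 h2
  have : 0 < expC ν k := by revert ν k; decide
  simpa [radicand] using this

theorem norm_prod_phase (S : Finset (Fin 8)) (e : Fin 8 → ℤ) (z : Fin 8 → ℂ)
    (hz : ∀ k ∈ S, z k ≠ 0) : ‖∏ k ∈ S, (z k / ‖z k‖) ^ e k‖ = 1 := by
  rw [norm_prod]
  refine Finset.prod_eq_one fun k hk => ?_
  have := hz k hk
  simp [norm_zpow, this]

theorem nonvanishing_others {ν : Fin 8} {z : Fin 8 → ℂ} (hz : z ∈ nonvanishing ν) :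
    ∀ k ∈ others ν, z k ≠ 0 := fun k hk => hz k (mem_others.1 hk).1 (mem_others.1 hk).2

theorem norm_coord {ν : Fin 8} {z : Fin 8 → ℂ} (hz : z ∈ nonvanishing ν) :
    ‖(coord ν z).1‖ = ‖z ν‖ ∧ ‖(coord ν z).2‖ = ‖z (ν + 1)‖ := by
  simp [coord, -norm_prod, norm_prod_phase _ _ _ (nonvanishing_others hz)]

theorem coord_mem {ν : Fin 8} {z : Fin 8 → ℂ} (hl : z ∈ levelSet) (hz : z ∈ nonvanishing ν) :
    coord ν z ∈ chartDomain ν := by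
  intro k h1 h2
  rw [← normSq_eq_radicand hl ν k (norm_coord hz).1 (norm_coord hz).2]
  have := hz k h1 h2
  positivity

theorem param_mem_nonvanishing {ν : Fin 8} {w : ℂ × ℂ} (hw : w ∈ chartDomain ν) :
    param ν w ∈ nonvanishing ν := by
  intro k h1 h2
  have := Real.sqrt_pos.2 (hw k h1 h2)
  simp [param, h1, h2, this.ne']

theorem coord_param {ν : Fin 8} {w : ℂ × ℂ} (hw : w ∈ chartDomain ν) :
    coord ν (param ν w) = w := by
  have h : ∀ k ∈ others ν, param ν w k / ‖param ν w k‖ = 1 := by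
    intro k hk
    obtain ⟨h1, h2⟩ := mem_others.1 hk
    have := Real.sqrt_pos.2 (hw k h1 h2)
    have h0 : ((√(radicand ν w k) : ℝ) : ℂ) ≠ 0 := by exact_mod_cast this.ne'
    simp only [param, h1, h2, if_false, Complex.norm_real, Real.norm_eq_abs, abs_of_pos this]
    exact div_self h0
  have hp : ∀ e : Fin 8 → ℤ, ∏ k ∈ others ν, (param ν w k / ‖param ν w k‖) ^ e k = 1 := fun e =>
    Finset.prod_eq_one fun k hk => by rw [h k hk, one_zpow]
  have hne : ν + 1 ≠ ν := by clear hp h hw; revert ν; decide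
  simp only [coord, hp, mul_one]
  simp [param, hne]

theorem eq_of_prod_A (a b c d e f : Circle)
    (h : a * (b * (c⁻¹ * (d⁻¹ * (e⁻¹ * f)))) = 1) : a * (b * (c⁻¹ * (e⁻¹ * f))) = d := by
  rw [← div_eq_one, ← h]
  simp only [div_eq_mul_inv, mul_comm, mul_left_comm]

theorem eq_of_prod_B (a b c d e f : Circle)
    (h : a * (b * (c * (d⁻¹ * (e⁻¹ * f⁻¹)))) = 1) : a * (b * (c * (d⁻¹ * f⁻¹))) = e := by
  rw [← div_eq_one, ← h]
  simp only [div_eq_mul_inv, mul_comm, mul_left_comm]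

/-- Elements of `𝕋⁸` that satisfy the two relations come from `𝕋⁶`. -/
theorem exists_torus (ν : Fin 8) (c : Fin 8 → Circle)
    (hA : ∏ k, c k ^ expA ν k = 1) (hB : ∏ k, c k ^ expB ν k = 1) :
    ∃ s : Torus, ∀ k, torusChar s k = c k := by
  have h : ∀ e : ℤ × ℤ → ℤ, (∀ m n : ℤ, ∀ x y, e (m • x + n • y) = m * e x + n * e y) →
      ∏ k, c k ^ e (normal k) = 1 := by
    intro e he
    have : ∀ k, c k ^ e (normal k) = (c k ^ expA ν k) ^ e (normal ν) *
        (c k ^ expB ν k) ^ e (normal (ν + 1)) := fun k => by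
      rw [← zpow_mul, ← zpow_mul, ← zpow_add, ← he, ← normal_eq]
    simp only [this, Finset.prod_mul_distrib, Finset.prod_zpow, hA, hB, one_zpow, mul_one]
  have h1 := h Prod.fst (by simp)
  have h2 := h Prod.snd (by simp)
  refine ⟨![c 0, c 1, c 2, c 3, (c 5)⁻¹, c 7], fun k => ?_⟩
  simp [normal, Fin.prod_univ_succ] at h1 h2
  fin_cases k <;> simp [torusChar, weight, Fin.prod_univ_succ]
  · exact eq_of_prod_A _ _ _ _ _ _ h1
  · exact eq_of_prod_B _ _ _ _ _ _ h2

theorem exp_arg {z : ℂ} (hz : z ≠ 0) : (Circle.exp z.arg : ℂ) = z / ‖z‖ := by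
  have h : (‖z‖ : ℂ) ≠ 0 := by simpa using hz
  rw [Circle.coe_exp, eq_div_iff h, mul_comm]
  exact Complex.norm_mul_exp_arg_mul_I z

theorem mk_param_coord {ν : Fin 8} (z : levelSet) (hz : z.1 ∈ nonvanishing ν)
    (h : param ν (coord ν z.1) ∈ levelSet) : mk ⟨param ν (coord ν z.1), h⟩ = mk z := by
  have hne : ν + 1 ≠ ν := by clear h hz; revert ν; decide
  obtain ⟨ph, hph⟩ : ∃ ph : Fin 8 → Circle, ∀ k ∈ others ν, (ph k : ℂ) = z.1 k / ‖z.1 k‖ :=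
    ⟨fun k => Circle.exp (z.1 k).arg, fun k hk => exp_arg (nonvanishing_others hz k hk)⟩
  let c : Fin 8 → Circle := fun k => if k = ν then ∏ j ∈ others ν, ph j ^ expA ν j else
    if k = ν + 1 then ∏ j ∈ others ν, ph j ^ expB ν j else (ph k)⁻¹
  have c0 : c ν = ∏ j ∈ others ν, ph j ^ expA ν j := by simp [c]
  have c1 : c (ν + 1) = ∏ j ∈ others ν, ph j ^ expB ν j := by simp [c, hne]
  have c2 : ∀ k ∈ others ν, c k = (ph k)⁻¹ := fun k hk => by
    simp [c, (mem_others.1 hk).1, (mem_others.1 hk).2]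
  have hc : ∀ e : Fin 8 → ℤ, ∏ k ∈ others ν, c k ^ e k = (∏ k ∈ others ν, ph k ^ e k)⁻¹ := fun e => by
    rw [← Finset.prod_inv_distrib]
    exact Finset.prod_congr rfl fun k hk => by rw [c2 k hk, inv_zpow]
  obtain ⟨s, hs⟩ := exists_torus ν c
    (by rw [prod_split ν, hc, c0]; simp [exp_diag ν])
    (by rw [prod_split ν, hc, c1]; simp [exp_diag ν])
  have hphase : ∀ e : Fin 8 → ℤ, ((∏ k ∈ others ν, ph k ^ e k : Circle) : ℂ) =
      ∏ k ∈ others ν, (z.1 k / ‖z.1 k‖) ^ e k := fun e => by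
    rw [coe_prod]
    exact Finset.prod_congr rfl fun k hk => by rw [Circle.coe_zpow, hph k hk]
  refine mk_eq_of_char s _ _ fun k => ?_
  rw [hs]
  by_cases h1 : k = ν
  · subst h1
    rw [c0, hphase, mul_comm]
    simp [param, coord]
  by_cases h2 : k = ν + 1
  · subst h2
    rw [c1, hphase, mul_comm]
    simp [param, coord, hne]
  · have hk := mem_others.2 ⟨h1, h2⟩
    have h0 := hz k h1 h2
    have hn : (‖z.1 k‖ : ℂ) ≠ 0 := by simpa using h0
    rw [c2 k hk, Circle.coe_inv, hph k hk, inv_div, div_mul_cancel₀ _ h0]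
    simp only [param, h1, h2, if_false]
    rw [← normSq_eq_radicand z.2 ν k (norm_coord hz).1 (norm_coord hz).2,
      Real.sqrt_sq (norm_nonneg _)]

theorem continuous_param (ν : Fin 8) : Continuous (param ν) := by
  refine continuous_pi fun k => ?_
  unfold param radicand
  split_ifs <;> fun_prop

open scoped Classical in
/-- The parametrisation `φ_ν` of `U_ν`; outside `chartDomain ν` the value is irrelevant. -/
def phi (ν : Fin 8) (w : ℂ × ℂ) : M :=
  if h : w ∈ chartDomain ν then mk ⟨param ν w, param_mem h⟩
  else mk ⟨param ν 0, param_mem (zero_mem_chartDomain ν)⟩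

theorem phi_of_mem {ν : Fin 8} {w : ℂ × ℂ} (h : w ∈ chartDomain ν) :
    phi ν w = mk ⟨param ν w, param_mem h⟩ := dif_pos h

theorem contDiffOn_coord (ν : Fin 8) : ContDiffOn ℝ ∞ (coord ν) (nonvanishing ν) := by
  have happ : ∀ k, ContDiff ℝ ∞ (fun z : Fin 8 → ℂ => z k) := fun k => contDiff_apply ℝ ℂ k
  have hprod : ∀ e : Fin 8 → ℤ, ContDiffOn ℝ ∞
      (fun z : Fin 8 → ℂ => ∏ k ∈ others ν, (z k / ‖z k‖) ^ e k) (nonvanishing ν) := by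
    intro e
    refine contDiffOn_prod fun k hk z hz => ContDiffAt.contDiffWithinAt ?_
    have h0 := nonvanishing_others hz k hk
    have hn : (‖z k‖ : ℂ) ≠ 0 := by simpa using h0
    have hd : ContDiffAt ℝ ∞ (fun z : Fin 8 → ℂ => z k / (‖z k‖ : ℂ)) z := by
      have h : ContDiffAt ℝ ∞ (fun z : Fin 8 → ℂ => (‖z k‖ : ℂ)) z :=
        Complex.ofRealCLM.contDiff.contDiffAt.comp z ((happ k).contDiffAt.norm ℝ h0)
      simp only [div_eq_mul_inv]
      exact (happ k).contDiffAt.mul (h.inv hn)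
    rcases e k with m | m
    · simpa using hd.pow m
    · simp only [zpow_negSucc]
      exact (hd.pow (m + 1)).inv (pow_ne_zero _ (div_ne_zero h0 hn))
  exact ((happ ν).contDiffOn.mul (hprod _)).prodMk ((happ (ν + 1)).contDiffOn.mul (hprod _))

theorem contDiffOn_param (ν : Fin 8) : ContDiffOn ℝ ∞ (param ν) (chartDomain ν) := by
  refine contDiffOn_pi.2 fun k => ?_
  unfold param
  split_ifs with h1 h2
  · exact contDiff_fst.contDiffOn
  · exact contDiff_snd.contDiffOn
  · refine Complex.ofRealCLM.contDiff.comp_contDiffOn (ContDiffOn.sqrt ?_ fun w hw =>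
      (hw k h1 h2).ne')
    unfold radicand
    exact ((((contDiff_const.mul (contDiff_fst.norm_sq ℝ)).add
      (contDiff_const.mul (contDiff_snd.norm_sq ℝ))).add contDiff_const)).contDiffOn

/-- The coordinate chart of `M` on `U_ν`, with inverse `φ_ν`. -/
def chart (ν : Fin 8) : OpenPartialHomeomorph M (ℂ × ℂ) where
  toFun := descend (coord ν) (coord_char ν)
  invFun := phi ν
  source := U ν
  target := chartDomain ν
  map_source' p hp := by
    obtain ⟨z, rfl, hz⟩ := hp
    exact coord_mem z.2 hz
  map_target' w hw := by
    rw [phi_of_mem hw]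
    exact mk_mem_U.2 (param_mem_nonvanishing hw)
  left_inv' p hp := by
    obtain ⟨z, rfl, hz⟩ := hp
    rw [descend_mk, phi_of_mem (coord_mem z.2 hz)]
    exact mk_param_coord z hz _
  right_inv' w hw := by
    rw [phi_of_mem hw, descend_mk]
    exact coord_param hw
  open_source := isOpen_U ν
  open_target := isOpen_chartDomain ν
  continuousOn_toFun := by
    have hq : Topology.IsQuotientMap mk := isQuotientMap_quotient_mk'
    refine (hq.continuousOn_isOpen_iff (isOpen_U ν)).2 ?_
    exact (contDiffOn_coord ν).continuousOn.comp continuous_subtype_val.continuousOn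
      fun z hz => mk_mem_U.1 hz
  continuousOn_invFun := by
    rw [continuousOn_iff_continuous_domRestrict]
    have : (chartDomain ν).domRestrict (phi ν) =
        fun w => mk ⟨param ν w.1, param_mem w.2⟩ := funext fun w => phi_of_mem w.2
    rw [this]
    exact continuous_mk.comp
      (((continuous_param ν).comp continuous_subtype_val).subtype_mk _)

/-- The eight charts cover `M`. -/
theorem exists_mem_U (p : M) : ∃ ν, p ∈ U ν := by
  obtain ⟨z, rfl⟩ := mk_surjective p
  simp only [mk_mem_U, nonvanishing, Set.mem_ofPred_eq]
  have h : ∀ k, ‖z.1 k‖ ^ 2 = _ := normSq_levelSet z.2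
  have h1 := h 1
  have h3 := h 3
  have h4 := h 4
  have h5 := h 5
  have h6 := h 6
  have h7 := h 7
  have hpos : ∀ k, 0 ≤ ‖z.1 k‖ ^ 2 := fun k => by positivity
  have hz : ∀ k, z.1 k = 0 → ‖z.1 k‖ ^ 2 = 0 := fun k hk => by simp [hk]
  simp [normal, support] at h1 h3 h4 h5 h6 h7
  have hcase : ∀ k : Fin 8, k = 0 ∨ k = 1 ∨ k = 2 ∨ k = 3 ∨ k = 4 ∨ k = 5 ∨ k = 6 ∨ k = 7 := by
    decide
  have p0 := hpos 0
  have p1 := hpos 1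
  have p2 := hpos 2
  have p3 := hpos 3
  have p4 := hpos 4
  have p5 := hpos 5
  have p6 := hpos 6
  have p7 := hpos 7
  by_cases c0 : z.1 0 = 0
  · have e0 := hz 0 c0
    by_cases c1 : z.1 1 = 0
    · have e1 := hz 1 c1
      refine ⟨0, fun k a b hk => ?_⟩
      have e := hz k hk
      rcases hcase k with rfl | rfl | rfl | rfl | rfl | rfl | rfl | rfl <;>
        first | exact a rfl | exact b rfl | linarith
    · refine ⟨7, fun k a b hk => ?_⟩
      have e := hz k hk
      rcases hcase k with rfl | rfl | rfl | rfl | rfl | rfl | rfl | rfl <;>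
        first | exact a rfl | exact b rfl | contradiction | linarith
  by_cases c1 : z.1 1 = 0
  · have e1 := hz 1 c1
    refine ⟨1, fun k a b hk => ?_⟩
    have e := hz k hk
    rcases hcase k with rfl | rfl | rfl | rfl | rfl | rfl | rfl | rfl <;>
      first | exact a rfl | exact b rfl | contradiction | linarith
  by_cases c2 : z.1 2 = 0
  · have e2 := hz 2 c2
    refine ⟨2, fun k a b hk => ?_⟩
    have e := hz k hk
    rcases hcase k with rfl | rfl | rfl | rfl | rfl | rfl | rfl | rfl <;>
      first | exact a rfl | exact b rfl | contradiction | linarith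
  by_cases c3 : z.1 3 = 0
  · have e3 := hz 3 c3
    refine ⟨3, fun k a b hk => ?_⟩
    have e := hz k hk
    rcases hcase k with rfl | rfl | rfl | rfl | rfl | rfl | rfl | rfl <;>
      first | exact a rfl | exact b rfl | contradiction | linarith
  by_cases c4 : z.1 4 = 0
  · have e4 := hz 4 c4
    refine ⟨4, fun k a b hk => ?_⟩
    have e := hz k hk
    rcases hcase k with rfl | rfl | rfl | rfl | rfl | rfl | rfl | rfl <;>
      first | exact a rfl | exact b rfl | contradiction | linarith
  by_cases c5 : z.1 5 = 0
  · have e5 := hz 5 c5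
    refine ⟨5, fun k a b hk => ?_⟩
    have e := hz k hk
    rcases hcase k with rfl | rfl | rfl | rfl | rfl | rfl | rfl | rfl <;>
      first | exact a rfl | exact b rfl | contradiction | linarith
  by_cases c6 : z.1 6 = 0
  · have e6 := hz 6 c6
    refine ⟨6, fun k a b hk => ?_⟩
    have e := hz k hk
    rcases hcase k with rfl | rfl | rfl | rfl | rfl | rfl | rfl | rfl <;>
      first | exact a rfl | exact b rfl | contradiction
  refine ⟨7, fun k a b hk => ?_⟩
  rcases hcase k with rfl | rfl | rfl | rfl | rfl | rfl | rfl | rfl <;>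
    first | exact a rfl | exact b rfl | contradiction

instance : ChartedSpace (ℂ × ℂ) M where
  atlas := Set.range chart
  chartAt p := chart (exists_mem_U p).choose
  mem_chart_source p := (exists_mem_U p).choose_spec
  chart_mem_atlas _ := ⟨_, rfl⟩

/-- `M` is a smooth (real) four-dimensional manifold. -/
instance : IsManifold 𝓘(ℝ, ℂ × ℂ) ∞ M := by
  refine isManifold_of_contDiffOn _ _ _ ?_
  rintro _ _ ⟨μ, rfl⟩ ⟨ν, rfl⟩
  have hs : ∀ w ∈ ((chart μ).symm.trans (chart ν)).source,
      w ∈ chartDomain μ ∧ param μ w ∈ nonvanishing ν := by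
    rintro w ⟨h1, h2⟩
    have h1 : w ∈ chartDomain μ := h1
    have h2 : phi μ w ∈ U ν := h2
    rw [phi_of_mem h1] at h2
    exact ⟨h1, mk_mem_U.1 h2⟩
  have : ContDiffOn ℝ ∞ (coord ν ∘ param μ) ((chart μ).symm.trans (chart ν)).source :=
    (contDiffOn_coord ν).comp ((contDiffOn_param μ).mono fun w hw => (hs w hw).1)
      fun w hw => (hs w hw).2
  simp only [modelWithCornersSelf_coe, modelWithCornersSelf_coe_symm, Function.id_comp,
    Function.comp_id, Set.preimage_id, Set.range_id, Set.inter_univ]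
  refine this.congr fun w hw => ?_
  show descend (coord ν) (coord_char ν) (phi μ w) = _
  rw [phi_of_mem (hs w hw).1]
  rfl

/-- A smooth invariant function on `ℂ⁸` descends to a smooth function on `M`. -/
theorem contMDiff_descend {F : Type*} [NormedAddCommGroup F] [NormedSpace ℝ F]
    (f : (Fin 8 → ℂ) → F) (hf : ∀ (s : Torus) (z : Fin 8 → ℂ),
      f (fun k => (torusChar s k : ℂ) * z k) = f z) (hs : ContDiff ℝ ∞ f) :
    ContMDiff 𝓘(ℝ, ℂ × ℂ) 𝓘(ℝ, F) ∞ (descend f hf) := by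
  rw [contMDiff_iff]
  constructor
  · exact (hs.continuous.comp continuous_subtype_val).quotient_lift _
  · intro p y
    simp only [mfld_simps]
    show ContDiffOn ℝ ∞ _ (_ ∩ Set.univ)
    rw [Set.inter_univ]
    refine (hs.comp_contDiffOn (contDiffOn_param (exists_mem_U p).choose)).congr fun w hw => ?_
    have hw : w ∈ chartDomain (exists_mem_U p).choose := hw
    show descend f hf (phi _ w) = _
    rw [phi_of_mem hw]
    rfl

/-! ### The family of systems -/

theorem norm_char (s : Torus) (k : Fin 8) (a : ℂ) : ‖(torusChar s k : ℂ) * a‖ = ‖a‖ := by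
  simp only [norm_mul, Circle.norm_coe, one_mul]

/-- `J([z]) = |z_1|² / 2`. -/
def J : M → ℝ := descend (fun z => ‖z 0‖ ^ 2 / 2) (by intro s z; simp only [norm_char])

/-- `H([z]) = |z_3|² / 2`. -/
def H : M → ℝ := descend (fun z => ‖z 2‖ ^ 2 / 2) (by intro s z; simp only [norm_char])

theorem gamma₁_invariant (s : Torus) (z : Fin 8 → ℂ) :
    1 / 50 * (starRingEnd ℂ ((torusChar s 1 * z 1) * (torusChar s 2 * z 2) * (torusChar s 3 * z 3)) *
      (torusChar s 5 * z 5) * (torusChar s 6 * z 6) * (torusChar s 7 * z 7)).re =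
    1 / 50 * (starRingEnd ℂ (z 1 * z 2 * z 3) * z 5 * z 6 * z 7).re := by
  have h := prod_char s (fun k => (normal k).2) (by decide)
  have h' : torusChar s 1 * torusChar s 2 * torusChar s 3 =
      torusChar s 5 * torusChar s 6 * torusChar s 7 := by
    simp [normal, Fin.prod_univ_succ] at h
    rw [← div_eq_one, ← h]
    simp only [div_eq_mul_inv, mul_inv, mul_assoc]
  have hc : starRingEnd ℂ (torusChar s 1 * torusChar s 2 * torusChar s 3) *
      (torusChar s 5 * torusChar s 6 * torusChar s 7) = 1 := by
    rw [← Circle.coe_mul, ← Circle.coe_mul, ← Circle.coe_mul, ← Circle.coe_mul, h',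
      ← Circle.coe_inv_eq_conj, ← Circle.coe_mul, inv_mul_cancel, Circle.coe_one]
  congr 2
  simp only [map_mul] at hc ⊢
  linear_combination (starRingEnd ℂ (z 1) * starRingEnd ℂ (z 2) * starRingEnd ℂ (z 3) *
    z 5 * z 6 * z 7) * hc

/-- `γ₁([z]) = Re (conj (z_2 z_3 z_4) z_6 z_7 z_8) / 50`. -/
def gamma₁ : M → ℝ :=
  descend (fun z => 1 / 50 * (starRingEnd ℂ (z 1 * z 2 * z 3) * z 5 * z 6 * z 7).re)
    gamma₁_invariant

/-- `γ₂([z]) = |z_5|⁴ |z_4|⁴ / 50`. -/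
def gamma₂ : M → ℝ :=
  descend (fun z => 1 / 50 * ‖z 4‖ ^ 4 * ‖z 3‖ ^ 4) (by intro s z; simp only [norm_char])

/-- `γ₃([z]) = |z_4|⁴ |z_7|⁴ / 50`. -/
def gamma₃ : M → ℝ :=
  descend (fun z => 1 / 50 * ‖z 3‖ ^ 4 * ‖z 6‖ ^ 4) (by intro s z; simp only [norm_char])

/-- `γ₄([z]) = |z_5|⁴ |z_7|⁴ / 100`. -/
def gamma₄ : M → ℝ :=
  descend (fun z => 1 / 100 * ‖z 4‖ ^ 4 * ‖z 6‖ ^ 4) (by intro s z; simp only [norm_char])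

/-- `H_t = (1 - 2 t_1) H + ∑ t_j γ_j`. -/
def Ht (t : Fin 4 → ℝ) (p : M) : ℝ :=
  (1 - 2 * t 0) * H p +
    (t 0 * gamma₁ p + t 1 * gamma₂ p + t 2 * gamma₃ p + t 3 * gamma₄ p)

/-- The momentum map `F_t = (J, H_t) : M → ℝ²`. -/
def F (t : Fin 4 → ℝ) (p : M) : EuclideanSpace ℝ (Fin 2) := !₂[J p, Ht t p]

theorem contMDiff_J : ContMDiff 𝓘(ℝ, ℂ × ℂ) 𝓘(ℝ, ℝ) ∞ J :=
  contMDiff_descend _ _ (((contDiff_apply ℝ ℂ 0).norm_sq ℝ).div_const 2)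

theorem contMDiff_H : ContMDiff 𝓘(ℝ, ℂ × ℂ) 𝓘(ℝ, ℝ) ∞ H :=
  contMDiff_descend _ _ (((contDiff_apply ℝ ℂ 2).norm_sq ℝ).div_const 2)

theorem contDiff_norm_four (k : Fin 8) : ContDiff ℝ ∞ fun z : Fin 8 → ℂ => ‖z k‖ ^ 4 := by
  have h := ((contDiff_apply ℝ ℂ k).norm_sq ℝ (n := ∞)).pow 2
  simpa only [← pow_mul] using h

theorem contMDiff_gamma₁ : ContMDiff 𝓘(ℝ, ℂ × ℂ) 𝓘(ℝ, ℝ) ∞ gamma₁ := by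
  have happ : ∀ k, ContDiff ℝ ∞ (fun z : Fin 8 → ℂ => z k) := fun k => contDiff_apply ℝ ℂ k
  have hconj : ContDiff ℝ ∞ fun z : Fin 8 → ℂ => starRingEnd ℂ (z 1 * z 2 * z 3) :=
    Complex.conjCLE.contDiff.comp (((happ 1).mul (happ 2)).mul (happ 3))
  exact contMDiff_descend _ _ (contDiff_const.mul (Complex.reCLM.contDiff.comp
    (((hconj.mul (happ 5)).mul (happ 6)).mul (happ 7))))

theorem contMDiff_gamma₂ : ContMDiff 𝓘(ℝ, ℂ × ℂ) 𝓘(ℝ, ℝ) ∞ gamma₂ :=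
  contMDiff_descend _ _ ((contDiff_const.mul (contDiff_norm_four 4)).mul (contDiff_norm_four 3))

theorem contMDiff_gamma₃ : ContMDiff 𝓘(ℝ, ℂ × ℂ) 𝓘(ℝ, ℝ) ∞ gamma₃ :=
  contMDiff_descend _ _ ((contDiff_const.mul (contDiff_norm_four 3)).mul (contDiff_norm_four 6))

theorem contMDiff_gamma₄ : ContMDiff 𝓘(ℝ, ℂ × ℂ) 𝓘(ℝ, ℝ) ∞ gamma₄ :=
  contMDiff_descend _ _ ((contDiff_const.mul (contDiff_norm_four 4)).mul (contDiff_norm_four 6))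

theorem contMDiff_Ht (t : Fin 4 → ℝ) : ContMDiff 𝓘(ℝ, ℂ × ℂ) 𝓘(ℝ, ℝ) ∞ (Ht t) :=
  (contMDiff_const.mul contMDiff_H).add
    ((((contMDiff_const.mul contMDiff_gamma₁).add (contMDiff_const.mul contMDiff_gamma₂)).add
      (contMDiff_const.mul contMDiff_gamma₃)).add (contMDiff_const.mul contMDiff_gamma₄))

/-- `F_t` is smooth, so that its differential has the intended meaning at every point. -/
theorem contMDiff_F (t : Fin 4 → ℝ) :
    ContMDiff 𝓘(ℝ, ℂ × ℂ) 𝓘(ℝ, EuclideanSpace ℝ (Fin 2)) ∞ (F t) := by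
  have h : F t = fun p => J p • (!₂[1, 0] : EuclideanSpace ℝ (Fin 2)) +
      Ht t p • (!₂[0, 1] : EuclideanSpace ℝ (Fin 2)) := by
    funext p
    ext i
    fin_cases i <;> simp [F]
  rw [h]
  exact (contMDiff_J.smul contMDiff_const).add ((contMDiff_Ht t).smul contMDiff_const)

/-! ### Singular points -/

/-- The rank of the differential at `p` of a map from `M` to the plane. -/
def rankAt (f : M → EuclideanSpace ℝ (Fin 2)) (p : M) : ℕ :=
  Module.finrank ℝ
    (mfderiv 𝓘(ℝ, ℂ × ℂ) 𝓘(ℝ, EuclideanSpace ℝ (Fin 2)) f p).toLinearMap.range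

/-- `p` is singular if the differential at `p` does not have maximal rank. -/
def IsSingularPoint (f : M → EuclideanSpace ℝ (Fin 2)) (p : M) : Prop := rankAt f p < 2

/-- `p` is a singular point of rank `r`. -/
def IsSingularPointOfRank (f : M → EuclideanSpace ℝ (Fin 2)) (r : ℕ) (p : M) : Prop :=
  IsSingularPoint f p ∧ rankAt f p = r

/-- Representatives of the four invariant singular points. -/
def invariantRep : Fin 4 → Fin 8 → ℝ :=
  ![![√2, 0, 0, √2, 2, 2 * √2, √6, √6],
    ![2, √2, 0, 0, √2, √6, √6, 2 * √2],
    ![2, 2 * √2, √6, √6, √2, 0, 0, √2],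
    ![√2, √6, √6, 2 * √2, 2, √2, 0, 0]]

theorem invariantRep_mem (i : Fin 4) : (fun k => (invariantRep i k : ℂ)) ∈ levelSet := by
  show momentL _ = 0
  funext j
  fin_cases i <;> fin_cases j <;>
    simp [momentL, weight, offset, invariantRep, Fin.sum_univ_succ, mul_pow] <;> norm_num

/-- The set of the four invariant singular points. -/
def invariantPoints : Set M :=
  Set.range fun i => mk ⟨fun k => (invariantRep i k : ℂ), invariantRep_mem i⟩

end Octagon

end

/-!
At a singular point of rank zero of `(J, H_t)` the differential of `J` alone vanishes, and this
already determines the conclusion; nothing about `H_t` is needed beyond its smoothness.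

In the chart coordinates `w` around the vertex `ν` of the octagon, `2 J` is
`expA ν 0 * |w.1|² + expB ν 0 * |w.2|²` plus a constant, so `dJ = 0` forces `w.1 = 0` unless
`expA ν 0 = 0`, and `w.2 = 0` unless `expB ν 0 = 0`
(`expA_mul_normSq_eq_zero_and_expB_mul_normSq_eq_zero`). These exponents vanish exactly when the
edge along which the coordinate varies is vertical, that is, when it is the edge `z_1 = 0` or the
edge `z_5 = 0`. Hence a critical point of `J` off these two edges lies over a vertex of the octagon,
and the four vertices off the two vertical edges are the four invariant singular points, because a
point of `M` over a vertex is determined by that vertex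
(`mk_eq_mk_of_eq_zero`). The values of `J` on the two edges are read off from the manifold equations.
-/

namespace Octagon

/-! ### The differential of `J` in the charts -/

theorem mfderiv_J_eq_zero {t : Fin 4 → ℝ} {p : M} (h : rankAt (F t) p = 0) :
    mfderiv 𝓘(ℝ, ℂ × ℂ) 𝓘(ℝ, ℝ) J p = 0 := by
  have hF : mfderiv 𝓘(ℝ, ℂ × ℂ) 𝓘(ℝ, EuclideanSpace ℝ (Fin 2)) (F t) p = 0 := by
    -- Stated on the model spaces, since instance search does not see the finite dimension of
    -- `TangentSpace`.
    have hL : ∀ L : ℂ × ℂ →L[ℝ] EuclideanSpace ℝ (Fin 2),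
        Module.finrank ℝ L.toLinearMap.range = 0 → L = 0 := fun L hL =>
      ContinuousLinearMap.coe_injective (LinearMap.range_eq_bot.1 (Submodule.finrank_eq_zero.1 hL))
    exact hL _ h
  have hd := ((contMDiff_F t).mdifferentiable (by simp) p).hasMFDerivAt
  rw [hF] at hd
  have hpr : HasMFDerivAt 𝓘(ℝ, EuclideanSpace ℝ (Fin 2)) 𝓘(ℝ, ℝ)
      (EuclideanSpace.proj (𝕜 := ℝ) (0 : Fin 2)) (F t p)
      (EuclideanSpace.proj (𝕜 := ℝ) (0 : Fin 2) : EuclideanSpace ℝ (Fin 2) →L[ℝ] ℝ) :=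
    (EuclideanSpace.proj (𝕜 := ℝ) (0 : Fin 2)).hasMFDerivAt
  have hc := hpr.comp p hd
  exact hc.mfderiv.trans (ContinuousLinearMap.comp_zero
    (EuclideanSpace.proj (𝕜 := ℝ) (0 : Fin 2) : EuclideanSpace ℝ (Fin 2) →L[ℝ] ℝ))

theorem J_phi {ν : Fin 8} {w : ℂ × ℂ} (hw : w ∈ chartDomain ν) :
    J (phi ν w) = radicand ν w 0 / 2 := by
  rw [phi_of_mem hw, J, descend_mk, normSq_param hw]

theorem hasFDerivAt_radicand_zero {ν : Fin 8} {w : ℂ × ℂ} (hw : w ∈ chartDomain ν)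
    (hJ : mfderiv 𝓘(ℝ, ℂ × ℂ) 𝓘(ℝ, ℝ) J (phi ν w) = 0) :
    HasFDerivAt (fun w => radicand ν w 0 / 2) (0 : ℂ × ℂ →L[ℝ] ℝ) w := by
  have hJd := (contMDiff_J.mdifferentiable (by simp) (phi ν w)).hasMFDerivAt
  rw [hJ] at hJd
  have hphi : MDifferentiableAt 𝓘(ℝ, ℂ × ℂ) 𝓘(ℝ, ℂ × ℂ) (phi ν) w :=
    mdifferentiableAt_atlas_symm (e := chart ν) (Set.mem_range_self ν) hw
  have hc := hJd.comp w hphi.hasMFDerivAt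
  rw [ContinuousLinearMap.zero_comp] at hc
  refine (hasMFDerivAt_iff_hasFDerivAt.1 hc).congr_of_eventuallyEq ?_
  filter_upwards [(isOpen_chartDomain ν).mem_nhds hw] with v hv
  exact (J_phi hv).symm

/-- The vanishing of `dJ` at a point of the chart domain around the vertex `ν`, in terms of the two
coordinates that may vanish there. -/
theorem expA_mul_normSq_eq_zero_and_expB_mul_normSq_eq_zero {ν : Fin 8} {z : levelSet}
    (hz : z.1 ∈ nonvanishing ν) (hJ : mfderiv 𝓘(ℝ, ℂ × ℂ) 𝓘(ℝ, ℝ) J (mk z) = 0) :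
    (expA ν 0 : ℝ) * ‖z.1 ν‖ ^ 2 = 0 ∧ (expB ν 0 : ℝ) * ‖z.1 (ν + 1)‖ ^ 2 = 0 := by
  have hw := coord_mem z.2 hz
  rw [← mk_param_coord z hz (param_mem hw), ← phi_of_mem hw] at hJ
  have hd := hasFDerivAt_radicand_zero hw hJ
  rw [← (norm_coord hz).1, ← (norm_coord hz).2]
  generalize coord ν z.1 = w at hd
  -- The derivative of `J` is evaluated in the two radial directions `(w.1, 0)` and `(0, w.2)`.
  have hsq : ∀ x : ℂ, HasDerivAt (fun s : ℝ => ‖(1 + s) • x‖ ^ 2) (2 * ‖x‖ ^ 2) 0 := fun x => by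
    simp only [norm_smul, mul_pow, Real.norm_eq_abs, sq_abs]
    simpa using (((hasDerivAt_id (0 : ℝ)).const_add 1).pow 2).mul_const (‖x‖ ^ 2)
  have hline : ∀ x : ℂ, HasDerivAt (fun s : ℝ => (1 + s) • x) x 0 := fun x => by
    simpa using ((hasDerivAt_id (0 : ℝ)).const_add 1).smul_const x
  constructor
  · have hl : HasDerivAt (fun s : ℝ => ((1 + s) • w.1, w.2)) (w.1, 0) 0 :=
      (hline w.1).prodMk (hasDerivAt_const _ _)
    have h1 := HasFDerivAt.comp_hasDerivAt_of_eq (0 : ℝ) hd hl (by simp)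
    have h2 := ((((hsq w.1).const_mul (expA ν 0 : ℝ)).add_const
      (expB ν 0 * ‖w.2‖ ^ 2)).add_const (expC ν 0 : ℝ)).div_const 2
    have h := h1.unique h2
    simp only [zero_apply] at h
    linarith
  · have hl : HasDerivAt (fun s : ℝ => (w.1, (1 + s) • w.2)) (0, w.2) 0 :=
      (hasDerivAt_const _ _).prodMk (hline w.2)
    have h1 := HasFDerivAt.comp_hasDerivAt_of_eq (0 : ℝ) hd hl (by simp)
    have h2 := ((((hsq w.2).const_mul (expB ν 0 : ℝ)).const_add
      (expA ν 0 * ‖w.1‖ ^ 2)).add_const (expC ν 0 : ℝ)).div_const 2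
    have h := h1.unique h2
    simp only [zero_apply] at h
    linarith

/-! ### Points over the vertices of the octagon -/

theorem mem_nonvanishing_of_eq_zero {ν : Fin 8} {z : Fin 8 → ℂ} (hz : z ∈ levelSet)
    (h1 : z ν = 0) (h2 : z (ν + 1) = 0) : z ∈ nonvanishing ν := by
  intro k hk1 hk2 h0
  have h := normSq_eq_radicand hz ν k (w := 0) (by simp [h1]) (by simp [h2])
  have hpos := zero_mem_chartDomain ν k hk1 hk2
  simp [← h, h0] at hpos

/-- There is only one point of `M` over each vertex of the octagon. -/
theorem mk_eq_mk_of_eq_zero {ν : Fin 8} {y z : levelSet} (hy1 : y.1 ν = 0)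
    (hy2 : y.1 (ν + 1) = 0) (hz1 : z.1 ν = 0) (hz2 : z.1 (ν + 1) = 0) : mk y = mk z := by
  have key : ∀ x : levelSet, x.1 ν = 0 → x.1 (ν + 1) = 0 → mk x = phi ν 0 := by
    intro x h1 h2
    have hx := mem_nonvanishing_of_eq_zero x.2 h1 h2
    have hc : coord ν x.1 = 0 := by simp [coord, h1, h2]
    rw [← mk_param_coord x hx (param_mem (coord_mem x.2 hx)),
      ← phi_of_mem (coord_mem x.2 hx), hc]
  rw [key y hy1 hy2, key z hz1 hz2]

theorem mk_mem_invariantPoints {ν : Fin 8} (hν : ν = 1 ∨ ν = 2 ∨ ν = 5 ∨ ν = 6) {z : levelSet}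
    (h1 : z.1 ν = 0) (h2 : z.1 (ν + 1) = 0) : mk z ∈ invariantPoints := by
  rcases hν with rfl | rfl | rfl | rfl
  · exact ⟨0, mk_eq_mk_of_eq_zero (ν := 1) (by simp [invariantRep]) (by simp [invariantRep]) h1 h2⟩
  · exact ⟨1, mk_eq_mk_of_eq_zero (ν := 2) (by simp [invariantRep]) (by simp [invariantRep]) h1 h2⟩
  · exact ⟨2, mk_eq_mk_of_eq_zero (ν := 5) (by simp [invariantRep]) (by simp [invariantRep]) h1 h2⟩
  · exact ⟨3, mk_eq_mk_of_eq_zero (ν := 6) (by simp [invariantRep]) (by simp [invariantRep]) h1 h2⟩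

/-- A critical point of `J` lies on one of the two vertical edges or over a vertex off them. -/
theorem eq_zero_or_mem_invariantPoints {z : levelSet}
    (hJ : mfderiv 𝓘(ℝ, ℂ × ℂ) 𝓘(ℝ, ℝ) J (mk z) = 0) :
    (z.1 0 = 0 ∨ z.1 4 = 0) ∨ mk z ∈ invariantPoints := by
  obtain ⟨ν, hν⟩ := exists_mem_U (mk z)
  obtain ⟨hA, hB⟩ := expA_mul_normSq_eq_zero_and_expB_mul_normSq_eq_zero (mk_mem_U.1 hν) hJ
  have hA : expA ν 0 = 0 ∨ z.1 ν = 0 := by simpa using hA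
  have hB : expB ν 0 = 0 ∨ z.1 (ν + 1) = 0 := by simpa using hB
  have hcase : ∀ ν : Fin 8, (ν = 0 ∧ expA ν 0 ≠ 0) ∨ (ν + 1 = 0 ∧ expB ν 0 ≠ 0) ∨
      (ν = 4 ∧ expA ν 0 ≠ 0) ∨ (ν + 1 = 4 ∧ expB ν 0 ≠ 0) ∨
      ((ν = 1 ∨ ν = 2 ∨ ν = 5 ∨ ν = 6) ∧ expA ν 0 ≠ 0 ∧ expB ν 0 ≠ 0) := by decide
  rcases hcase ν with ⟨h, h'⟩ | ⟨h, h'⟩ | ⟨h, h'⟩ | ⟨h, h'⟩ | ⟨h, hA', hB'⟩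
  · exact Or.inl (Or.inl (h ▸ hA.resolve_left h'))
  · exact Or.inl (Or.inl (h ▸ hB.resolve_left h'))
  · exact Or.inl (Or.inr (h ▸ hA.resolve_left h'))
  · exact Or.inl (Or.inr (h ▸ hB.resolve_left h'))
  · exact Or.inr (mk_mem_invariantPoints h (hA.resolve_left hA') (hB.resolve_left hB'))

end Octagon

theorem mainTheorem3 (t : Fin 4 → ℝ) (z : Octagon.levelSet)
    (hsing : Octagon.IsSingularPointOfRank (Octagon.F t) 0 (Octagon.mk z))
    (hinv : Octagon.mk z ∉ Octagon.invariantPoints) :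
    (z.1 0 = 0 ∨ z.1 4 = 0) ∧
      (z.1 0 = 0 → Octagon.J (Octagon.mk z) = 0) ∧
      (z.1 4 = 0 → Octagon.J (Octagon.mk z) = 3) := by
  refine ⟨(Octagon.eq_zero_or_mem_invariantPoints
    (Octagon.mfderiv_J_eq_zero hsing.2)).resolve_right hinv, fun h => ?_, fun h => ?_⟩
  · simp [Octagon.J, Octagon.descend_mk, h]
  · have h4 := Octagon.normSq_levelSet z.2 4
    simp [Octagon.normal, Octagon.support, h] at h4
    rw [Octagon.J, Octagon.descend_mk]
    linarith
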